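/- **Setting.** Let $\Lambda$ be a set of unary modal operators with an involution $\heartsuit\mapsto\overline\heartsuit$ (duals), $F\colon\mathsf{Set}\to\mathsf{Set}$ a functor, and let each $\heartsuit\in\Lambda$ be interpreted by a monotone predicate lifting, i.e. by maps $[\![\heartsuit]\!]_U\colon\mathcal P(U)\to\mathcal P(FU)$ that are monotone and natural ($[\![\heartsuit]\!]_U(f^{-1}[Z])=(Ff)^{-1}[[\![\heartsuit]\!]_V(Z)]$ for $f\colon U\to V$), with $[\![\overline\heartsuit]\!]_U(A)=FU\setminus[\![\heartsuit]\!]_U(U\setminus A)$. Formulae are given by $$\phi::=\bot\mid\top\mid\phi\wedge\phi\mid\phi\vee\phi\mid\heartsuit\phi\mid X\mid\neg X\mid\mu X.\,\phi\mid\nu X.\,\phi,$$ where $\neg X$ may not occur in the scope of $\mu X$ or $\nu X$. Let $\chi$ be a closed formula in which each variable is bound by at most one fixpoint operator; let $n_0=|\chi|$ be its length (number of symbols). For a bound variable $X$ of $\chi$ let $\theta(X)$ be the subformula $\eta X.\,\psi$ of $\chi$. A dependency chain is a sequence $X_0,\dots,X_n$ of bound variables such that $\theta(X_{i+1})$ is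 a subformula of $\theta(X_i)$ and $X_i$ is free in $\theta(X_{i+1})$ for all $i<n$; its alternation number is $1$ plus the number of $i<n$ such that one of $X_i,X_{i+1}$ is bound by $\mu$ and the other by $\nu$. Let $\mathsf{ad}(X)$ be the maximal alternation number of dependency chains with $X_0=X$, and let $k=\max_X\mathsf{ad}(X)$, or $k=1$ if $\chi$ contains no fixpoint operators. **Tracking automaton.** Let $\mathbf F$ be the Fischer-Ladner closure of $\chi$, i.e. the least set of formulae containing $\chi$ and closed under passing from $\phi\wedge\psi$ and $\phi\vee\psi$ to $\phi,\psi$, from $\heartsuit\phi$ to $\phi$, and from $\eta X.\,\phi$ to $\phi[\eta X.\,\phi/X]$. A *choice* is a function $\tau$ that maps every disjunction in $\mathbf F$ to one of its disjuncts; a *selection* is a set $\kappa$ of formulae of the form $\heartsuit\psi$ in $\mathbf F$. Let $\Sigma$ be the disjoint union of the sets $\mathsf{choices}$ and $\mathsf{selections}$. The tracking automaton $\mathsf A_\chi$ is the nondeterministic parity automaton with states $\mathbf F$, initial state $\chi$, alphabet $\Sigma$, and transitions $\Delta(\psi_1\vee\psi_2,\tau)=\{\tau(\psi_1\vee\psi_2)\}$,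 $\Delta(\psi_1\wedge\psi_2,\tau)=\{\psi_1,\psi_2\}$, $\Delta(\eta X.\,\psi,\tau)=\{\psi[\eta X.\,\psi/X]\}$, $\Delta(\heartsuit\psi,\tau)=\{\heartsuit\psi\}$, $\Delta(\top,\tau)=\Delta(\bot,\tau)=\emptyset$, $\Delta(\psi,\kappa)=\{\psi_0\}$ if $\psi=\heartsuit\psi_0\in\kappa$, and $\Delta(\psi,\kappa)=\emptyset$ otherwise; the priority of $\mu X.\,\phi$ is $2\,\mathsf{ad}(X)$, that of $\nu X.\,\phi$ is $2\,\mathsf{ad}(X)-1$, and that of every other formula is $1$. A parity automaton accepts an infinite word if it has a run on it on which the highest priority occurring infinitely often is even. Let $\mathsf B_\chi=(D_\chi,\Sigma,\delta,q_{\mathsf{init}},\Omega)$ be a co-determinized tracking automaton: a finite deterministic parity automaton (with total transition function $\delta\colon D_\chi\times\Sigma\to D_\chi$) with priorities $\Omega(q)\in\{1,\dots,2n_0k\}$ and $L(\mathsf B_\chi)=\Sigma^\omega\setminus L(\mathsf A_\chi)$, equipped with a labelling $l\colon D_\chi\to\mathcal P(\mathbf F)$ such that $l(q_{\mathsf{init}})=\{\chi\}$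 and $l(\delta(q,a))=\bigcup_{\psi\in l(q)}\Delta(\psi,a)$ for all $q\in D_\chi$, $a\in\Sigma$. **One-step satisfiability.** For $\Theta\subseteq\mathcal P(\mathbf F)$, $\psi\in\mathbf F$ and a set $\gamma$ of formulae $\heartsuit\psi$ with $\psi\in\mathbf F$, put $[\![\psi]\!]_0^\Theta=\{u\in\Theta\mid\psi\in u\}$ and $[\![\gamma]\!]_1^\Theta=\bigcap_{\heartsuit\psi\in\gamma}[\![\heartsuit]\!]_\Theta([\![\psi]\!]_0^\Theta)\subseteq F\Theta$. Let $\gamma_q$ be the set of formulae of the form $\heartsuit\psi$ in $l(q)$. **Fixpoint.** For $X_1,\dots,X_{2n_0k}\subseteq D_\chi$ let $f(X_1,\dots,X_{2n_0k})$ be the set of all $q\in D_\chi$ such that $[\![\gamma_q]\!]_1^{\Theta}\neq\emptyset$ for $\Theta=l[\{\delta(q,\kappa)\mid\kappa\in\mathsf{selections}\}\cap X_{\Omega(q)}]$, $\bot\notin l(q)$, and $\delta(q,\tau)\in X_{\Omega(q)}$ for some $\tau\in\mathsf{choices}$. Put $$\mathbf E=\eta_{2n_0k}X_{2n_0k}.\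 \ldots\ \eta_1X_1.\ f(X_1,\dots,X_{2n_0k}),$$ where $\eta_i=\mu$ (least fixpoint) for odd $i$ and $\eta_i=\nu$ (greatest fixpoint) for even $i$. **Satisfiability game.** The parity game $\mathsf G_\chi$ has the following nodes and moves, for $q\in D_\chi$ and $\Xi\subseteq\mathsf{selections}$. - $q$ belongs to $\forall$, has priority $\Omega(q)$, and has moves to $(q,0)$ and $(q,1)$. - $(q,0)$ belongs to $\exists$, has priority $0$, and has moves to $\delta(q,\tau)$ for all $\tau\in\mathsf{choices}$ if $\bot\notin l(q)$, and no moves otherwise. - $(q,1)$ belongs to $\exists$, has priority $0$, and has moves to all $(q,\Xi)$ with $[\![\gamma_q]\!]_1^{\Theta}\neq\emptyset$ for $\Theta=l[\{\delta(q,\kappa)\mid\kappa\in\Xi\}]$. - $(q,\Xi)$ belongs to $\forall$, has priority $0$, and has moves to $\delta(q,\kappa)$ for all $\kappa\in\Xi$. A player who is stuck loses; an infinite play is won by $\exists$ iff the highest priority visited infinitely often is even; $\exists$ wins a node if she has a (possibly history-dependent) strategy such that she wins every maximal play that starts at this node and follows the strategy. **Lemma.** For all $q\in D_\chi$, we have $q\in\mathbf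 E$ if and only if the existential player wins the node $q$ in $\mathsf G_\chi$. -/

import Mathlib

open CategoryTheory

universe u w

namespace CoalgMu

/-! ### Coalgebraic logics -/

/-- A monotone unary predicate lifting for a set functor `F`: a natural transformation from the
contravariant powerset functor `Q` to `Q ∘ Fᵒᵖ`, written out, all of whose components are
monotone. -/
structure PredLifting (F : Type u ⥤ Type u) where
  app : (U : Type u) → Set U → Set (F.obj U)
  natural : ∀ {U V : Type u} (f : U → V) (Z : Set V),
    app U (f ⁻¹' Z) = (fun t => F.map (TypeCat.ofHom f) t) ⁻¹' app V Z
  mono : ∀ (U : Type u) {A A' : Set U}, A ⊆ A' → app U A ⊆ app U A'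

/-- The parameters of the coalgebraic `μ`-calculus: a modal similarity type `Λ` (of unary
modalities) closed under duals, a set functor `F`, and an interpretation of the modalities by
monotone predicate liftings for `F` that respects duality. -/
structure CoalgLogic where
  Λ : Type u
  dual : Λ → Λ
  dual_dual : ∀ h, dual (dual h) = h
  F : Type u ⥤ Type u
  sem : Λ → PredLifting F
  sem_dual : ∀ (h : Λ) (U : Type u) (A : Set U), (sem (dual h)).app U A = ((sem h).app U Aᶜ)ᶜ

/-! ### Formulae -/

/-- The (countably infinite) set of fixpoint variables. -/
abbrev Var : Type := ℕ

/-- The two fixpoint operators. -/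
inductive FixOp : Type
  | mu
  | nu

/-- Formulae of the coalgebraic `μ`-calculus; `fix η X φ` is `η X. φ`. -/
inductive Formula (Λ : Type u) : Type u
  | bot : Formula Λ
  | top : Formula Λ
  | and : Formula Λ → Formula Λ → Formula Λ
  | or : Formula Λ → Formula Λ → Formula Λ
  | modal : Λ → Formula Λ → Formula Λ
  | var : Var → Formula Λ
  | negVar : Var → Formula Λ
  | fix : FixOp → Var → Formula Λ → Formula Λ

namespace Formula

variable {Λ : Type u}

/-- Free fixpoint variables. -/
def FV : Formula Λ → Set Var
  | bot => ∅
  | top => ∅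
  | and φ ψ => FV φ ∪ FV ψ
  | or φ ψ => FV φ ∪ FV ψ
  | modal _ φ => FV φ
  | var X => {X}
  | negVar X => {X}
  | fix _ X φ => FV φ \ {X}

/-- The list of variables bound by the fixpoint operators occurring in a formula, with one entry
per occurrence of an operator. -/
def binders : Formula Λ → List Var
  | bot => []
  | top => []
  | and φ ψ => binders φ ++ binders ψ
  | or φ ψ => binders φ ++ binders ψ
  | modal _ φ => binders φ
  | var _ => []
  | negVar _ => []
  | fix _ X φ => X :: binders φ

/-- The variables that occur negated in a formula. -/
def negVars : Formula Λ → Set Var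
  | bot => ∅
  | top => ∅
  | and φ ψ => negVars φ ∪ negVars ψ
  | or φ ψ => negVars φ ∪ negVars ψ
  | modal _ φ => negVars φ
  | var _ => ∅
  | negVar X => {X}
  | fix _ _ φ => negVars φ

/-- The syntactic restriction on negation: `¬X` does not occur in the scope of `μX` or `νX`. -/
def WellFormed : Formula Λ → Prop
  | bot => True
  | top => True
  | and φ ψ => WellFormed φ ∧ WellFormed ψ
  | or φ ψ => WellFormed φ ∧ WellFormed ψ
  | modal _ φ => WellFormed φ
  | var _ => True
  | negVar _ => True
  | fix _ X φ => X ∉ negVars φ ∧ WellFormed φ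

/-- A formula is closed if it has no free fixpoint variables. -/
def Closed (φ : Formula Λ) : Prop := FV φ = ∅

/-- A formula is clean if each fixpoint variable appears in at most one fixpoint operator. -/
def Clean (φ : Formula Λ) : Prop := (binders φ).Nodup

/-- The set of subformulae. -/
def sub : Formula Λ → Set (Formula Λ)
  | bot => {bot}
  | top => {top}
  | and φ ψ => insert (and φ ψ) (sub φ ∪ sub ψ)
  | or φ ψ => insert (or φ ψ) (sub φ ∪ sub ψ)
  | modal h φ => insert (modal h φ) (sub φ)
  | var X => {var X}
  | negVar X => {negVar X}
  | fix η X φ => insert (fix η X φ) (sub φ)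

/-- The length `|φ|`: the number of symbols from
`{⊥, ⊤, ∧, ∨} ∪ Λ ∪ Var ∪ {ηX. | η ∈ {μ, ν}, X ∈ Var}`. -/
def length : Formula Λ → ℕ
  | bot => 1
  | top => 1
  | and φ ψ => length φ + length ψ + 1
  | or φ ψ => length φ + length ψ + 1
  | modal _ φ => length φ + 1
  | var _ => 1
  | negVar _ => 1
  | fix _ _ φ => length φ + 1

/-- `subst X ρ φ` is `φ[ρ/X]`. It is used only to unfold closed fixpoints `ρ = ηX. φ`, so there is
no variable capture, and `¬X` does not occur in `φ`. -/
def subst (X : Var) (ρ : Formula Λ) : Formula Λ → Formula Λ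
  | bot => bot
  | top => top
  | and φ ψ => and (subst X ρ φ) (subst X ρ ψ)
  | or φ ψ => or (subst X ρ φ) (subst X ρ ψ)
  | modal h φ => modal h (subst X ρ φ)
  | var Y => if Y = X then ρ else var Y
  | negVar Y => negVar Y
  | fix η Y φ => if Y = X then fix η Y φ else fix η Y (subst X ρ φ)

/-- `φ` is a disjunction. -/
def IsOr (φ : Formula Λ) : Prop := ∃ ψ₁ ψ₂, φ = or ψ₁ ψ₂

/-- `φ` is of the form `♡ψ`. -/
def IsModal (φ : Formula Λ) : Prop := ∃ h ψ, φ = modal h ψ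

/-! ### Alternation depth, relative to a target formula `χ` -/

/-- `θ = θ(X)`: it is the subformula of `χ` of the shape `ηX. ψ` (unique if `χ` is clean). -/
def IsTheta (χ : Formula Λ) (X : Var) (θ : Formula Λ) : Prop :=
  θ ∈ sub χ ∧ ∃ η ψ, θ = fix η X ψ

/-- `X` is an `η`-variable. -/
def IsEtaVar (χ : Formula Λ) (η : FixOp) (X : Var) : Prop := ∃ ψ, fix η X ψ ∈ sub χ

/-- `DepLt χ Y X`: `θ(Y)` is a subformula of `θ(X)`, and `X` is free in `θ(Y)`. -/
def DepLt (χ : Formula Λ) (Y X : Var) : Prop :=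
  ∃ θY θX, IsTheta χ Y θY ∧ IsTheta χ X θX ∧ θY ∈ sub θX ∧ X ∈ FV θY

/-- A dependency chain `X_n ≺ … ≺ X_0` in `χ` of bound variables. -/
def IsDepChain (χ : Formula Λ) (n : ℕ) (c : Fin (n + 1) → Var) : Prop :=
  (∀ i, c i ∈ binders χ) ∧ ∀ i : Fin n, DepLt χ (c i.succ) (c i.castSucc)

/-- The alternation number of a chain: one plus the number of `i` at which it toggles between
`μ`- and `ν`-variables. -/
noncomputable def altNumber (χ : Formula Λ) (n : ℕ) (c : Fin (n + 1) → Var) : ℕ :=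
  {i : Fin n | IsEtaVar χ .mu (c i.castSucc) ↔ IsEtaVar χ .nu (c i.succ)}.ncard + 1

/-- The alternation depth of a variable: the maximal alternation number of dependency chains ending
in `X_0 = X` (chains in a clean formula have bounded length, so the supremum is a maximum). -/
noncomputable def adVar (χ : Formula Λ) (X : Var) : ℕ :=
  sSup {m | ∃ (n : ℕ) (c : Fin (n + 1) → Var), IsDepChain χ n c ∧ c 0 = X ∧ m = altNumber χ n c}

/-- The alternation depth of `χ`; it is `0` if `χ` contains no fixpoint operator. -/
noncomputable def ad (χ : Formula Λ) : ℕ := (binders χ).toFinset.sup (adVar χ)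

/-- The Fischer-Ladner closure of `χ`. -/
inductive InClosure (χ : Formula Λ) : Formula Λ → Prop
  | self : InClosure χ χ
  | and_left {φ ψ} : InClosure χ (and φ ψ) → InClosure χ φ
  | and_right {φ ψ} : InClosure χ (and φ ψ) → InClosure χ ψ
  | or_left {φ ψ} : InClosure χ (or φ ψ) → InClosure χ φ
  | or_right {φ ψ} : InClosure χ (or φ ψ) → InClosure χ ψ
  | modal {h φ} : InClosure χ (modal h φ) → InClosure χ φ
  | unfold {η X φ} : InClosure χ (fix η X φ) → InClosure χ (subst X (fix η X φ) φ)

end Formula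

/-! ### Parity automata -/

/-- The maximum of the set of numbers occurring infinitely often in `p` exists and is even. -/
def MaxInfEven (p : ℕ → ℕ) : Prop :=
  ∃ m, IsGreatest {m | ∃ᶠ n in Filter.atTop, p n = m} m ∧ Even m

/-- A nondeterministic parity automaton over the alphabet `S` with set of nodes `V`. -/
structure ParityAutomaton (V : Type*) (S : Type*) where
  trans : V → S → V → Prop
  start : V
  priority : V → ℕ

/-- The language of infinite words accepted by a parity automaton. -/
def ParityAutomaton.language {V S : Type*} (A : ParityAutomaton V S) : Set (ℕ → S) :=
  {x | ∃ ρ : ℕ → V, ρ 0 = A.start ∧ (∀ i, A.trans (ρ i) (x i) (ρ (i + 1))) ∧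
    MaxInfEven fun i => A.priority (ρ i)}

/-! ### The tracking automaton -/

section Tracking

variable {Λ : Type u}

/-- The Fischer-Ladner closure as a type. -/
abbrev Closure (χ : Formula Λ) : Type u := {φ : Formula Λ // Formula.InClosure χ φ}

/-- Choice functions, picking a disjunct from each disjunction in the closure. -/
def Choice (χ : Formula Λ) : Type u :=
  {τ : {φ : Closure χ // φ.1.IsOr} → Closure χ //
    ∀ φ ψ₁ ψ₂, φ.1.1 = Formula.or ψ₁ ψ₂ → (τ φ).1 = ψ₁ ∨ (τ φ).1 = ψ₂}

/-- Selections: sets of modal literals in the closure. -/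
abbrev Selection (χ : Formula Λ) : Type u := Set {φ : Closure χ // φ.1.IsModal}

/-- The alphabet: the disjoint union of the set of choice functions and the set of selections. -/
inductive Letter (χ : Formula Λ) : Type u
  | choice : Choice χ → Letter χ
  | sel : Selection χ → Letter χ

/-- The transition relation `Δ` of the tracking automaton. -/
inductive Track (χ : Formula Λ) : Closure χ → Letter χ → Closure χ → Prop
  | or (τ : Choice χ) (φ : Closure χ) (h : φ.1.IsOr) : Track χ φ (.choice τ) (τ.1 ⟨φ, h⟩)
  | and_left (τ : Choice χ) (φ ψ : Closure χ) (ρ : Formula Λ) :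
      φ.1 = .and ψ.1 ρ → Track χ φ (.choice τ) ψ
  | and_right (τ : Choice χ) (φ ψ : Closure χ) (ρ : Formula Λ) :
      φ.1 = .and ρ ψ.1 → Track χ φ (.choice τ) ψ
  | unfold (τ : Choice χ) (φ ψ : Closure χ) (η : FixOp) (X : Var) (ρ : Formula Λ) :
      φ.1 = .fix η X ρ → ψ.1 = ρ.subst X φ.1 → Track χ φ (.choice τ) ψ
  | modal (τ : Choice χ) (φ : Closure χ) : φ.1.IsModal → Track χ φ (.choice τ) φ
  | sel (κ : Selection χ) (φ ψ : Closure χ) (h : Λ) (hφ : φ.1.IsModal) :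
      (⟨φ, hφ⟩ : {φ : Closure χ // φ.1.IsModal}) ∈ κ → φ.1 = .modal h ψ.1 →
      Track χ φ (.sel κ) ψ

/-- The priority function of the tracking automaton. -/
noncomputable def trackPriority (χ : Formula Λ) : Formula Λ → ℕ
  | .fix .mu X _ => 2 * χ.adVar X
  | .fix .nu X _ => 2 * χ.adVar X - 1
  | _ => 1

/-- The tracking automaton for `χ`. -/
noncomputable def trackingAutomaton (χ : Formula Λ) :
    ParityAutomaton (Closure χ) (Letter χ) where
  trans := Track χ
  start := ⟨χ, .self⟩
  priority φ := trackPriority χ φ.1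

/-- The number `2 n₀ k` of priorities of the co-determinized tracking automaton, where `n₀ = |χ|`
and `k` is the alternation depth of `χ`, read as `1` if `χ` contains no fixpoint operators (an
automaton needs at least one priority). -/
noncomputable def numPriorities (χ : Formula Λ) : ℕ := 2 * χ.length * max 1 χ.ad

/-- Co-determinized tracking automata for `χ`, as produced by any determinization procedure (such
as the Safra/Piterman construction) followed by complementation: finite deterministic parity
automata with priorities `1, …, 2 n₀ k` that accept the complement of the language of the tracking
automaton, together with a labelling of states by sets of formulae that evolves under transitions
like macrostates in the powerset construction. -/
structure CoDetTracking (χ : Formula Λ) where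
  D : Type w
  finite : Finite D
  δ : D → Letter χ → D
  start : D
  Ω : D → ℕ
  one_le_Ω : ∀ q, 1 ≤ Ω q
  Ω_le : ∀ q, Ω q ≤ numPriorities χ
  language_eq : (ParityAutomaton.mk (fun q a q' => δ q a = q') start Ω).language =
    (trackingAutomaton χ).languageᶜ
  lab : D → Set (Closure χ)
  lab_start : lab start = {⟨χ, .self⟩}
  lab_δ : ∀ q a, lab (δ q a) = {ψ | ∃ φ ∈ lab q, Track χ φ a ψ}

end Tracking

/-! ### One-step satisfiability -/

/-- The interpretation of `a ∈ V` over `Θ ⊆ 𝒫 V`. -/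
def sem0 {V : Type u} (Θ : Set (Set V)) (a : V) : Set Θ := {v | a ∈ v.1}

/-- The interpretation of a set `γ` of modal literals over `V` (the pair `(♡, a)` stands for `♡a`)
over `Θ ⊆ 𝒫 V`, a subset of `F Θ`. -/
def sem1 (L : CoalgLogic.{u}) {V : Type u} (γ : Set (L.Λ × V)) (Θ : Set (Set V)) :
    Set (L.F.obj Θ) :=
  ⋂ p ∈ γ, (L.sem p.1).app Θ (sem0 Θ p.2)

/-- One-step satisfiability is monotone in `Θ`. -/
theorem sem1_nonempty_mono (L : CoalgLogic.{u}) {V : Type u} (γ : Set (L.Λ × V))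
    {Θ Θ' : Set (Set V)} (h : Θ ⊆ Θ') (hs : (sem1 L γ Θ).Nonempty) :
    (sem1 L γ Θ').Nonempty := by
  obtain ⟨t, ht⟩ := hs
  refine ⟨L.F.map (TypeCat.ofHom (Set.inclusion h)) t, ?_⟩
  simp only [sem1, Set.mem_iInter] at ht ⊢
  intro p hp
  have h1 := ht p hp
  have h2 : sem0 Θ p.2 = Set.inclusion h ⁻¹' sem0 Θ' p.2 := rfl
  rw [h2, (L.sem p.1).natural] at h1
  exact h1

section Game

variable (L : CoalgLogic.{u}) {χ : Formula L.Λ} (B : CoDetTracking.{u, w} χ)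

/-- The set `l(q) ∩ Λ(𝐅)` of modal literals in the label of `q`. -/
def modalLits (q : B.D) : Set (L.Λ × Closure χ) :=
  {p | ∃ φ ∈ B.lab q, φ.1 = .modal p.1 p.2.1}

/-- The label of `q` contains `⊥`. -/
def HasBot (q : B.D) : Prop := ∃ φ ∈ B.lab q, φ.1 = .bot

/-- The set `δ(q, selections)`. -/
def selSucc (q : B.D) : Set B.D := Set.range fun κ : Selection χ => B.δ q (.sel κ)

/-! ### The fixpoint -/

/-- The one-step propagation function `f`. Its argument is the family of the sets `X_i`, of which
only `X_1, …, X_{2 n₀ k}` matter. -/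
def propagate (X : ℕ → Set B.D) : Set B.D :=
  {q | (sem1 L (modalLits L B q) (B.lab '' (selSucc L B q ∩ X (B.Ω q)))).Nonempty ∧
    ¬ HasBot L B q ∧ ∃ τ : Choice χ, B.δ q (.choice τ) ∈ X (B.Ω q)}

theorem propagate_mono : Monotone (propagate L B) := by
  rintro X Y h q ⟨h1, h2, τ, h3⟩
  refine ⟨sem1_nonempty_mono L _ ?_ h1, h2, τ, h _ h3⟩
  exact Set.image_mono (Set.inter_subset_inter_right _ (h _))

end Game

/-- `nestedFix f i X` is `η_i X_i. … η_1 X_1. f(X_1, X_2, …)` as a function of the remaining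
variables, where `η_j = μ` for odd `j` and `η_j = ν` for even `j`. -/
def nestedFix {α : Type*} [CompleteLattice α] (f : (ℕ → α) →o α) : ℕ → ((ℕ → α) →o α)
  | 0 => f
  | i + 1 =>
    { toFun := fun X =>
        let g : α →o α :=
          ⟨fun A => nestedFix f i (Function.update X (i + 1) A),
            fun _ _ h => (nestedFix f i).monotone (Function.update_mono h)⟩
        if Odd (i + 1) then OrderHom.lfp g else OrderHom.gfp g
      monotone' := by
        intro X Y h
        have key : ∀ A, nestedFix f i (Function.update X (i + 1) A) ≤
            nestedFix f i (Function.update Y (i + 1) A) := fun A =>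
          (nestedFix f i).monotone (update_le_update_iff.2 ⟨le_rfl, fun j _ => h j⟩)
        dsimp only
        split_ifs
        · exact OrderHom.lfp.monotone key
        · exact OrderHom.gfp.monotone key }

/-- The set `𝐄 = η_{2n₀k} X_{2n₀k}. … η_1 X_1. f(X_1, …, X_{2n₀k})`. All relevant variables are
bound, so the values initially assigned to them are irrelevant. -/
noncomputable def fixE (L : CoalgLogic.{u}) {χ : Formula L.Λ} (B : CoDetTracking.{u, w} χ) :
    Set B.D :=
  nestedFix ⟨propagate L B, propagate_mono L B⟩ (numPriorities χ) fun _ => ∅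

/-! ### Parity games -/

/-- A parity game on the set `V` of nodes (without designated initial node); the nodes outside
`exNodes` belong to the universal player. -/
structure ParityGame (V : Type*) where
  exNodes : Set V
  move : V → V → Prop
  priority : V → ℕ

namespace ParityGame

variable {V : Type*} (G : ParityGame V)

/-- A play is a maximal path `node 0, node 1, …`; it is infinite if `last = ⊤`, and otherwise it
ends in `node last`, a node without outgoing moves (later values of `node` are meaningless). -/
structure Play where
  last : ℕ∞
  node : ℕ → V
  move_node : ∀ i : ℕ, (i : ℕ∞) < last → G.move (node i) (node (i + 1))
  maximal : ∀ n : ℕ, last = n → ∀ v, ¬ G.move (node n) v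

/-- A (history-dependent) strategy for the existential player maps a partial play `v_0, …, v_n`
ending in one of her nodes to a legal move from `v_n`, provided there is one; other values are
meaningless. -/
def IsStrategy (s : List V → V) : Prop :=
  ∀ (h : List V) (v : V), v ∈ G.exNodes → (∃ v', G.move v v') → G.move v (s (h ++ [v]))

variable {G}

/-- The play follows the strategy `s` of the existential player. -/
def Play.Follows (π : G.Play) (s : List V → V) : Prop :=
  ∀ n : ℕ, (n : ℕ∞) < π.last → π.node n ∈ G.exNodes →
    π.node (n + 1) = s ((List.range (n + 1)).map π.node)

/-- The play is winning for the existential player: it is finite and the universal player is stuck,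
or it is infinite and the highest priority visited infinitely often is even. -/
def Play.ExWins (π : G.Play) : Prop :=
  (∃ n : ℕ, π.last = n ∧ π.node n ∉ G.exNodes) ∨
    (π.last = ⊤ ∧ MaxInfEven fun i => G.priority (π.node i))

variable (G)

/-- The existential player wins the node `v`. -/
def ExWinsNode (v : V) : Prop :=
  ∃ s, G.IsStrategy s ∧ ∀ π : G.Play, π.node 0 = v → π.Follows s → π.ExWins

end ParityGame

/-! ### The satisfiability game -/

section SatGame

variable (L : CoalgLogic.{u}) {χ : Formula L.Λ} (B : CoDetTracking.{u, w} χ)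

/-- The nodes `q`, `(q, 0)`, `(q, 1)` and `(q, Ξ)` of the satisfiability game. -/
inductive SatNode : Type (max u w)
  | state : B.D → SatNode
  | zero : B.D → SatNode
  | one : B.D → SatNode
  | sels : B.D → Set (Selection χ) → SatNode

/-- The moves of the satisfiability game. -/
inductive SatMove : SatNode L B → SatNode L B → Prop
  | to_zero (q : B.D) : SatMove (.state q) (.zero q)
  | to_one (q : B.D) : SatMove (.state q) (.one q)
  | choose (q : B.D) (τ : Choice χ) : ¬ HasBot L B q →
      SatMove (.zero q) (.state (B.δ q (.choice τ)))
  | select (q : B.D) (Ξ : Set (Selection χ)) :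
      (sem1 L (modalLits L B q) (B.lab '' ((fun κ => B.δ q (.sel κ)) '' Ξ))).Nonempty →
      SatMove (.one q) (.sels q Ξ)
  | step (q : B.D) (Ξ : Set (Selection χ)) (κ : Selection χ) : κ ∈ Ξ →
      SatMove (.sels q Ξ) (.state (B.δ q (.sel κ)))

/-- The satisfiability game. -/
def satGame : ParityGame (SatNode L B) where
  exNodes := {v | ∃ q, v = .zero q ∨ v = .one q}
  move := SatMove L B
  priority
    | .state q => B.Ω q
    | _ => 0

end SatGame

end CoalgMu

namespace CoalgMu

/-! ### Numbers occurring infinitely often -/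

/-! The function `propagate` has the form `{q | P q (X (Ω q))}`, where `P q A` says that from `q`
the existential player can answer both moves of the universal player so that the next state lies in
`A`. Thus `fixE` is a nested fixpoint of a one-round condition, and the claim is the usual
correspondence between such fixpoints and parity games.

The core is `exists_trace`: membership in a nested fixpoint is witnessed by an edge relation `T`
along which the one-round condition can be met forever, and such that on every infinite `T`-path the
highest recurring priority belongs to a greatest fixpoint. A least fixpoint is the union of its
finite approximants, as the state space is finite; the stage at which a state enters is a rank that
strictly drops at the priority of that fixpoint, provided no higher priority intervenes.

Applied to `fixE`, `T` gives the existential player a positional winning strategy. Applied to the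
complement of `fixE`, where least and greatest fixpoints swap roles, it gives the universal player a
positional strategy with odd outcome. Playing the latter against an alleged winning strategy of the
existential player yields a contradiction, so determinacy is not needed. -/

/-- The set of numbers occurring infinitely often in a sequence. -/
def infOcc (p : ℕ → ℕ) : Set ℕ := {m | ∃ᶠ n in Filter.atTop, p n = m}

theorem infOcc_shift (p : ℕ → ℕ) (k : ℕ) : infOcc (fun n => p (n + k)) = infOcc p := by
  ext m
  simp only [infOcc, Set.mem_ofPred_eq]
  conv_rhs => rw [← Filter.map_add_atTop_eq_nat k, Filter.frequently_map]

/-! ### Traces through nested fixpoints -/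

/-- Unfolding of nested fixpoints along edges: `W i X` is an `i`-fold nested fixpoint of
`X ↦ {q | P q (X (Ω q))}`, in which the variable `X j` is bound by a least fixpoint iff `Q j`. The
edge relation `T` witnesses membership, and the maximal priority that occurs infinitely often along
a `T`-path belongs to a greatest fixpoint. -/
theorem exists_trace {D : Type*} (P : D → Set D → Prop) (hP : ∀ q, Monotone (P q)) (Ω : D → ℕ)
    (hΩ : ∀ q, 1 ≤ Ω q) (Q : ℕ → Prop) (W : ℕ → (ℕ → Set D) → Set D)
    (h0 : ∀ X, ∀ q ∈ W 0 X, P q (X (Ω q)))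
    (hl : ∀ i X, Q (i + 1) → ∃ A : ℕ → Set D, A 0 = ∅ ∧
      (∀ n, A (n + 1) = W i (Function.update X (i + 1) (A n))) ∧ W (i + 1) X = ⋃ n, A n)
    (hg : ∀ i X, ¬ Q (i + 1) →
      W (i + 1) X = W i (Function.update X (i + 1) (W (i + 1) X))) :
    ∀ i X, ∃ T : D → D → Prop,
      (∀ q ∈ W i X,
        P q {q' | (Ω q ≤ i → q' ∈ W i X ∧ T q q') ∧ (i < Ω q → q' ∈ X (Ω q))}) ∧
      ∀ p : ℕ → D, (∀ n, T (p n) (p (n + 1))) → (∀ n, Ω (p n) ≤ i) →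
        ∃ m, IsGreatest (infOcc fun n => Ω (p n)) m ∧ ¬ Q m := by
  intro i
  induction i with
  | zero =>
    intro X
    refine ⟨fun _ _ => True, fun q hq => hP q ?_ (h0 X q hq), fun p _ hp => ?_⟩
    · exact fun q' hq' => ⟨fun h => absurd (hΩ q) (by omega), fun _ => hq'⟩
    · exact absurd (hp 0) (by have := hΩ (p 0); omega)
  | succ i ih =>
    intro X
    by_cases hQ : Q (i + 1)
    · obtain ⟨A, hA0, hA, hW⟩ := hl i X hQ
      choose T hT hT' using fun n => ih (Function.update X (i + 1) (A n))
      -- Since `A 0` is empty, each member first enters at a positive stage `rk q + 1`. The shift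
      -- makes `A (rk q)` the parameter under which membership of `q` unfolds.
      let rk : D → ℕ := fun q => sInf {n | q ∈ A (n + 1)}
      have rk_lt : ∀ {q n}, q ∈ A n → rk q < n := by
        intro q n hq
        cases n with
        | zero => simp [hA0] at hq
        | succ n => exact Nat.lt_succ_of_le (Nat.sInf_le hq)
      have mem_rk : ∀ {q}, q ∈ W (i + 1) X → q ∈ A (rk q + 1) := by
        intro q hq
        rw [hW, Set.mem_iUnion] at hq
        obtain ⟨n, hn⟩ := hq
        cases n with
        | zero => simp [hA0] at hn
        | succ n => exact Nat.sInf_mem (s := {n | q ∈ A (n + 1)}) ⟨n, hn⟩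
      have sub : ∀ n, A n ⊆ W (i + 1) X := fun n => hW ▸ Set.subset_iUnion A n
      -- The rank never grows and drops when `X (i + 1)` is unfolded; while it is constant, the
      -- edges are those of one fixed approximant.
      refine ⟨fun q q' => rk q' ≤ rk q ∧ (Ω q = i + 1 → rk q' < rk q) ∧
        (rk q' = rk q → T (rk q) q q'), fun q hq => ?_, fun p hp hb => ?_⟩
      · refine hP q ?_ (hT (rk q) q (hA _ ▸ mem_rk hq))
        rintro q' ⟨h1, h2⟩
        rcases lt_trichotomy (Ω q) (i + 1) with h | h | h
        · obtain ⟨h3, h4⟩ := h1 (by omega)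
          rw [← hA] at h3
          exact ⟨fun _ => ⟨sub _ h3, Nat.le_of_lt_succ (rk_lt h3), by omega, fun _ => h4⟩,
            by omega⟩
        · have h3 := h2 (by omega)
          rw [h, Function.update_self] at h3
          have := rk_lt h3
          exact ⟨fun _ => ⟨sub _ h3, this.le, fun _ => this, by omega⟩, by omega⟩
        · have h3 := h2 (by omega)
          rw [Function.update_of_ne (by omega)] at h3
          exact ⟨by omega, fun _ => h3⟩
      -- Ranks along the path stabilize from some `N` on. Thereafter priority `i + 1` cannot occur,
      -- and the induction hypothesis for that single approximant applies to the tail.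
      · have anti : Antitone fun n => rk (p n) := antitone_nat_of_succ_le fun n => (hp n).1
        obtain ⟨N, hmin⟩ : ∃ N, ∀ m, rk (p N) ≤ rk (p m) :=
          ⟨Function.argmin fun n => rk (p n), fun m => Function.argmin_le (fun n => rk (p n)) m⟩
        have hN : ∀ m, N ≤ m → rk (p N) = rk (p m) := fun m h => (hmin m).antisymm (anti h)
        obtain ⟨m, hm, hm'⟩ := hT' (rk (p N)) (fun n => p (n + N))
          (fun n => by
            have h1 := hN (n + N) (by omega)
            have h2 := hN (n + 1 + N) (by omega)
            have h3 := (hp (n + N)).2.2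
            rw [show n + N + 1 = n + 1 + N by omega] at h3
            rw [h1]
            exact h3 (by omega))
          (fun n => by
            have h1 := hN (n + N) (by omega)
            have h2 := hN (n + N + 1) (by omega)
            have h3 := (hp (n + N)).2.1
            have h4 := hb (n + N)
            by_contra h5
            have := h3 (by omega)
            omega)
        exact ⟨m, infOcc_shift (fun n => Ω (p n)) N ▸ hm, hm'⟩
    -- Only the fixpoint equation is used here. The parameter reproduces itself, so no rank is
    -- needed, and edges leaving states of priority `i + 1` may be unconstrained: if that priority
    -- recurs, it is the required maximum.
    · have hW := hg i X hQ
      obtain ⟨T, hT, hT'⟩ := ih (Function.update X (i + 1) (W (i + 1) X))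
      rw [← hW] at hT
      refine ⟨fun q q' => Ω q ≤ i → T q q', fun q hq => ?_, fun p hp hb => ?_⟩
      · refine hP q ?_ (hT q hq)
        rintro q' ⟨h1, h2⟩
        rcases lt_trichotomy (Ω q) (i + 1) with h | h | h
        · obtain ⟨h3, h4⟩ := h1 (by omega)
          exact ⟨fun _ => ⟨h3, fun _ => h4⟩, by omega⟩
        · have h3 := h2 (by omega)
          rw [h, Function.update_self] at h3
          exact ⟨fun _ => ⟨h3, by omega⟩, by omega⟩
        · have h3 := h2 (by omega)
          rw [Function.update_of_ne (by omega)] at h3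
          exact ⟨by omega, fun _ => h3⟩
      · by_cases hf : ∃ᶠ n in Filter.atTop, Ω (p n) = i + 1
        · refine ⟨i + 1, ⟨hf, fun m hm => ?_⟩, hQ⟩
          obtain ⟨n, hn⟩ := Filter.Frequently.exists hm
          exact hn ▸ hb n
        · rw [Filter.not_frequently, Filter.eventually_atTop] at hf
          obtain ⟨N, hN⟩ := hf
          have hle : ∀ n, Ω (p (n + N)) ≤ i := fun n => by
            have := hN (n + N) (by omega)
            have := hb (n + N)
            omega
          obtain ⟨m, hm, hm'⟩ := hT' (fun n => p (n + N))
            (fun n => by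
              have := hp (n + N) (hle n)
              rwa [show n + N + 1 = n + 1 + N by omega] at this) hle
          exact ⟨m, infOcc_shift (fun n => Ω (p n)) N ▸ hm, hm'⟩

/-! ### Approximating fixpoints over finite lattices -/

/-- In a finite lattice the increasing chain of iterates stabilizes, and its final value is a
fixpoint. -/
theorem lfp_eq_iSup_iterate {α : Type*} [CompleteLattice α] [Finite α] (g : α →o α) :
    OrderHom.lfp g = ⨆ n, g^[n] ⊥ := by
  apply le_antisymm
  · have hm : Monotone fun n => g^[n] ⊥ := g.monotone.monotone_iterate_of_le_map bot_le
    obtain ⟨n, hn⟩ := WellFoundedGT.monotone_chain_condition (α := α) ⟨_, hm⟩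
    have h : g^[n] ⊥ = g^[n + 1] ⊥ := hn (n + 1) (by omega)
    rw [Function.iterate_succ_apply'] at h
    exact (OrderHom.lfp_le g h.ge).trans (le_iSup (fun n => g^[n] ⊥) n)
  · refine iSup_le fun n => ?_
    induction n with
    | zero => exact bot_le
    | succ n ih =>
      rw [Function.iterate_succ_apply', ← OrderHom.map_lfp]
      exact g.monotone ih

theorem gfp_eq_iInf_iterate {α : Type*} [CompleteLattice α] [Finite α] (g : α →o α) :
    OrderHom.gfp g = ⨅ n, g^[n] ⊤ :=
  lfp_eq_iSup_iterate (α := αᵒᵈ) g.dual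

section NestedFix

variable {D : Type*} (f : (ℕ → Set D) →o Set D)

/-- The operator whose least or greatest fixpoint defines `nestedFix f (i + 1) X`. -/
def nestedStep (i : ℕ) (X : ℕ → Set D) : Set D →o Set D :=
  ⟨fun A => nestedFix f i (Function.update X (i + 1) A),
    fun _ _ h => (nestedFix f i).monotone (Function.update_mono h)⟩

theorem nestedFix_succ_of_odd {i : ℕ} (X : ℕ → Set D) (h : Odd (i + 1)) :
    nestedFix f (i + 1) X = OrderHom.lfp (nestedStep f i X) := by
  change (if Odd (i + 1) then _ else _) = _
  rw [if_pos h]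
  rfl

theorem nestedFix_succ_of_not_odd {i : ℕ} (X : ℕ → Set D) (h : ¬ Odd (i + 1)) :
    nestedFix f (i + 1) X = OrderHom.gfp (nestedStep f i X) := by
  change (if Odd (i + 1) then _ else _) = _
  rw [if_neg h]
  rfl

theorem nestedFix_succ (i : ℕ) (X : ℕ → Set D) :
    nestedFix f (i + 1) X =
      nestedFix f i (Function.update X (i + 1) (nestedFix f (i + 1) X)) := by
  change _ = nestedStep f i X _
  by_cases h : Odd (i + 1)
  · rw [nestedFix_succ_of_odd f X h, OrderHom.map_lfp]
  · rw [nestedFix_succ_of_not_odd f X h, OrderHom.map_gfp]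

variable [Finite D] (P : D → Set D → Prop) (Ω : D → ℕ)

/-- A trace witnessing membership in a nested fixpoint. -/
theorem exists_trace_nestedFix (hP : ∀ q, Monotone (P q)) (hΩ : ∀ q, 1 ≤ Ω q)
    (hf : ∀ X, f X = {q | P q (X (Ω q))}) (N : ℕ) (hN : ∀ q, Ω q ≤ N) (X : ℕ → Set D) :
    ∃ T : D → D → Prop, (∀ q ∈ nestedFix f N X, P q {q' | q' ∈ nestedFix f N X ∧ T q q'}) ∧
      ∀ p : ℕ → D, (∀ n, T (p n) (p (n + 1))) →
        ∃ m, IsGreatest (infOcc fun n => Ω (p n)) m ∧ Even m := by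
  obtain ⟨T, hT, hT'⟩ := exists_trace P hP Ω hΩ Odd (fun i X => nestedFix f i X)
    (fun X q hq => by
      change q ∈ f X at hq
      rwa [hf] at hq)
    (fun i X h => ⟨fun n => (nestedStep f i X)^[n] ∅, rfl,
      fun n => Function.iterate_succ_apply' _ _ _, by
        rw [nestedFix_succ_of_odd f X h, lfp_eq_iSup_iterate]
        rfl⟩)
    (fun i X _ => nestedFix_succ f i X) N X
  -- All priorities are at most `N`, so no free variable is ever consulted.
  refine ⟨T, fun q hq => hP q (fun q' h => h.1 (hN q)) (hT q hq), fun p hp => ?_⟩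
  simpa only [Nat.not_odd_iff_even] using hT' p hp fun n => hN _

/-- A trace witnessing non-membership in a nested fixpoint. -/
theorem exists_trace_compl_nestedFix (hP : ∀ q, Monotone (P q)) (hΩ : ∀ q, 1 ≤ Ω q)
    (hf : ∀ X, f X = {q | P q (X (Ω q))}) (N : ℕ) (hN : ∀ q, Ω q ≤ N) (X : ℕ → Set D) :
    ∃ T : D → D → Prop,
      (∀ q ∉ nestedFix f N X, ¬ P q {q' | q' ∉ nestedFix f N X → ¬ T q q'}) ∧
      ∀ p : ℕ → D, (∀ n, T (p n) (p (n + 1))) →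
        ∃ m, IsGreatest (infOcc fun n => Ω (p n)) m ∧ Odd m := by
  have hc : ∀ (X : ℕ → Set D) i A, (Function.update X i A)ᶜ = Function.update Xᶜ i Aᶜ := by
    intro X i A
    ext j
    by_cases h : j = i
    · subst h; simp
    · simp [h]
  -- De Morgan dual: complements of the decreasing approximants of a greatest fixpoint increase from
  -- the empty set, so even indices now play the least-fixpoint role. For odd indices the fixpoint
  -- equation alone suffices.
  obtain ⟨T, hT, hT'⟩ := exists_trace (fun q A => ¬ P q Aᶜ)
    (fun q A B h hA hB => hA (hP q (Set.compl_subset_compl.2 h) hB)) Ω hΩ Even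
    (fun i X => (nestedFix f i Xᶜ)ᶜ)
    (fun X q hq => by
      change q ∉ f Xᶜ at hq
      rwa [hf] at hq)
    (fun i X h => ⟨fun n => ((nestedStep f i Xᶜ)^[n] ⊤)ᶜ, by simp,
      fun n => by
        simp only [Function.iterate_succ_apply', hc, compl_compl]
        rfl, by
        rw [nestedFix_succ_of_not_odd f _ (Nat.not_odd_iff_even.2 h), gfp_eq_iInf_iterate]
        exact Set.compl_iInter _⟩)
    (fun i X _ => by
      rw [hc, compl_compl]
      exact congrArg _ (nestedFix_succ f i Xᶜ)) N Xᶜ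
  rw [compl_compl] at hT
  refine ⟨T, fun q hq h => hT q hq (hP q (fun q' h' h'' => ?_) h), fun p hp => ?_⟩
  · exact h' (h''.1 (hN q)).1 (h''.1 (hN q)).2
  · simpa only [Nat.not_even_iff_odd] using hT' p hp fun n => hN _

end NestedFix

/-! ### Plays of parity games -/

namespace ParityGame

variable {V : Type*} (G : ParityGame V)

/-- The partial play of length `n + 1` from `v` that follows the strategy `s` of the existential
player and the positional strategy `t` of the universal player. -/
noncomputable def history (s : List V → V) (t : V → V) (v : V) : ℕ → List V × V
  | 0 => ([], v)
  | n + 1 =>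
    let h := history s t v n
    (h.1 ++ [h.2], open Classical in if h.2 ∈ G.exNodes then s (h.1 ++ [h.2]) else t h.2)

/-- A strategy of the existential player and a positional strategy of the universal player that is
legal on a set of nodes closed under the resulting moves determine a play. -/
theorem exists_play {s : List V → V} (hs : G.IsStrategy s) (t : V → V) (I : Set V)
    (hI : ∀ v ∈ I, ∀ v', G.move v v' → (v ∉ G.exNodes → v' = t v) → v' ∈ I)
    (ht : ∀ v ∈ I, v ∉ G.exNodes → G.move v (t v)) (v : V) (hv : v ∈ I) :
    ∃ π : G.Play, π.node 0 = v ∧ π.Follows s ∧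
      (∀ n : ℕ, (n : ℕ∞) < π.last → π.node n ∉ G.exNodes → π.node (n + 1) = t (π.node n)) ∧
      ∀ n : ℕ, (n : ℕ∞) ≤ π.last → π.node n ∈ I := by
  let x : ℕ → V := fun n => (G.history s t v n).2
  have hx : ∀ n, (G.history s t v n).1 = (List.range n).map x := by
    intro n
    induction n with
    | zero => rfl
    | succ n ih =>
      rw [List.range_succ, List.map_append, ← ih]
      rfl
  have hex : ∀ n, x n ∈ G.exNodes → x (n + 1) = s ((List.range (n + 1)).map x) := by
    intro n h
    rw [← hx]
    exact if_pos h
  have hall : ∀ n, x n ∉ G.exNodes → x (n + 1) = t (x n) := fun n h => if_neg h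
  have hmove : ∀ n, x n ∈ I → (∃ v', G.move (x n) v') → G.move (x n) (x (n + 1)) := by
    intro n hn h
    by_cases he : x n ∈ G.exNodes
    · rw [hex n he, List.range_succ, List.map_append]
      exact hs _ _ he h
    · rw [hall n he]
      exact ht _ hn he
  -- The sequence `x` continues past dead ends with meaningless values, so a finite play is cut at
  -- the first stuck node.
  by_cases hstuck : ∃ n, ∀ v', ¬ G.move (x n) v'
  · classical
    have hlt : ∀ i, i < Nat.find hstuck → ∃ v', G.move (x i) v' := fun i hi => by
      simpa using Nat.find_min hstuck hi
    have hmem : ∀ i, i ≤ Nat.find hstuck → x i ∈ I := by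
      intro i
      induction i with
      | zero => exact fun _ => hv
      | succ i ih =>
        exact fun hi => hI _ (ih (by omega)) _ (hmove i (ih (by omega)) (hlt i (by omega)))
          (hall i)
    refine ⟨⟨(Nat.find hstuck : ℕ), x, fun i hi => ?_, fun n hn => ?_⟩, rfl,
      fun n _ => hex n, fun n _ => hall n, fun n hn => hmem n (ENat.natCast_le_natCast.1 hn)⟩
    · have hi : i < Nat.find hstuck := by exact_mod_cast hi
      exact hmove i (hmem i hi.le) (hlt i hi)
    · have hn : Nat.find hstuck = n := by exact_mod_cast hn
      exact hn ▸ Nat.find_spec hstuck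
  · push Not at hstuck
    have hmem : ∀ i, x i ∈ I := by
      intro i
      induction i with
      | zero => exact hv
      | succ i ih => exact hI _ ih _ (hmove i ih (hstuck i)) (hall i)
    exact ⟨⟨⊤, x, fun i _ => hmove i (hmem i) (hstuck i), fun n hn => absurd hn (by simp)⟩, rfl,
      fun n _ => hex n, fun n _ => hall n, fun n _ => hmem n⟩

end ParityGame

/-! ### Strategies in the satisfiability game -/

section SatGame

variable {L : CoalgLogic.{u}} {χ : Formula L.Λ} {B : CoDetTracking.{u, w} χ}

/-- The states visited by an infinite play of the satisfiability game form a path along the edges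
that connect states visited in succession, with the same positive priorities occurring infinitely
often. -/
theorem exists_state_path (x : ℕ → SatNode L B) (T : B.D → B.D → Prop)
    (h0 : ∃ q, x 0 = .state q)
    (hx : ∀ n q, x n = .state q →
      (x (n + 1) = .zero q ∧ ∃ q', x (n + 2) = .state q' ∧ T q q') ∨
      (x (n + 1) = .one q ∧ (∃ Ξ, x (n + 2) = .sels q Ξ) ∧ ∃ q', x (n + 3) = .state q' ∧ T q q')) :
    ∃ p : ℕ → B.D, (∀ n, T (p n) (p (n + 1))) ∧
      ∀ m, IsGreatest (infOcc fun n => B.Ω (p n)) m →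
        IsGreatest (infOcc fun n => (satGame L B).priority (x n)) m := by
  have hnext : ∀ a : {n : ℕ × B.D // x n.1 = .state n.2}, ∃ b : {n : ℕ × B.D // x n.1 = .state n.2},
      T a.1.2 b.1.2 ∧ a.1.1 < b.1.1 ∧
      ∀ j, a.1.1 < j → j < b.1.1 → (satGame L B).priority (x j) = 0 := by
    rintro ⟨⟨n, q⟩, hq⟩
    rcases hx n q hq with ⟨h1, q', h2, h3⟩ | ⟨h1, ⟨Ξ, h4⟩, q', h2, h3⟩
    · refine ⟨⟨(n + 2, q'), h2⟩, h3, by simp, fun j hj hj' => ?_⟩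
      simp only at hj hj'
      obtain rfl : j = n + 1 := by omega
      rw [h1]; rfl
    · refine ⟨⟨(n + 3, q'), h2⟩, h3, by simp, fun j hj hj' => ?_⟩
      simp only at hj hj'
      obtain rfl | rfl : j = n + 1 ∨ j = n + 2 := by omega
      · rw [h1]; rfl
      · rw [h4]; rfl
  choose next hT hlt hzero using hnext
  obtain ⟨q₀, hq₀⟩ := h0
  let a : ℕ → {n : ℕ × B.D // x n.1 = .state n.2} := fun k => next^[k] ⟨(0, q₀), hq₀⟩
  have ha : ∀ k, a (k + 1) = next (a k) := fun k => Function.iterate_succ_apply' _ _ _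
  have hmono : StrictMono fun k => (a k).1.1 := strictMono_nat_of_lt_succ fun k => by
    rw [ha]; exact hlt _
  have hprio : ∀ k, (satGame L B).priority (x (a k).1.1) = B.Ω (a k).1.2 := fun k => by
    rw [(a k).2]; rfl
  -- Every position of the play is either an auxiliary node of priority 0 or one of the enumerated
  -- states.
  have hcov : ∀ k n, n < (a k).1.1 →
      (satGame L B).priority (x n) = 0 ∨ ∃ j, (a j).1.1 = n := by
    intro k
    induction k with
    | zero => intro n hn; exact absurd hn (Nat.not_lt_zero n)
    | succ k ih =>
      intro n hn
      rcases lt_trichotomy n (a k).1.1 with h | h | h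
      · exact ih n h
      · exact .inr ⟨k, h.symm⟩
      · rw [ha] at hn
        exact .inl (hzero _ n h hn)
  refine ⟨fun k => (a k).1.2, fun k => by simp only [ha]; exact hT _, fun m hm => ⟨?_, fun m' hm' => ?_⟩⟩
  · have := hm.1
    simp only [infOcc, Set.mem_ofPred_eq, Filter.frequently_atTop] at this ⊢
    intro k
    obtain ⟨b, hb, hb'⟩ := this k
    exact ⟨(a b).1.1, hb.trans hmono.le_apply, by rw [hprio, hb']⟩
  -- Auxiliary nodes may make 0 recur, but 0 cannot exceed `m`.
  · by_cases h : m' = 0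
    · omega
    · refine hm.2 ?_
      simp only [infOcc, Set.mem_ofPred_eq, Filter.frequently_atTop] at hm' ⊢
      intro k
      obtain ⟨n, hn, hn'⟩ := hm' (a k).1.1
      obtain h1 | ⟨j, rfl⟩ := hcov (n + 1) n (lt_of_lt_of_le (Nat.lt_succ_self n) hmono.le_apply)
      · omega
      · exact ⟨j, hmono.le_iff_le.1 hn, by rw [← hprio, hn']⟩

variable (L B) in
/-- The one-step condition on a state `q` whose successors are supposed to be in `A`. -/
def Propagates (q : B.D) (A : Set B.D) : Prop :=
  (sem1 L (modalLits L B q) (B.lab '' (selSucc L B q ∩ A))).Nonempty ∧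
    ¬ HasBot L B q ∧ ∃ τ : Choice χ, B.δ q (.choice τ) ∈ A

theorem propagates_mono (q : B.D) : Monotone (Propagates L B q) := by
  rintro A A' h ⟨h1, h2, τ, h3⟩
  exact ⟨sem1_nonempty_mono L _ (Set.image_mono (Set.inter_subset_inter_right _ h)) h1, h2, τ,
    h h3⟩

/-- This makes legal the move to the set of all selections that are safe with respect to `A`. -/
theorem propagates_selections {q : B.D} {A : Set B.D} (h : Propagates L B q A) :
    (sem1 L (modalLits L B q) (B.lab '' ((fun κ => B.δ q (.sel κ)) ''
      {κ : Selection χ | B.δ q (.sel κ) ∈ A}))).Nonempty := by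
  refine sem1_nonempty_mono L _ (Set.image_mono ?_) h.1
  rintro _ ⟨⟨κ, rfl⟩, hκ⟩
  exact ⟨κ, hκ, rfl⟩

/-- The existential player moves so that consecutive states stay in `fixE` and are joined by `T`.
She is then never stuck, and infinite plays inherit the even maximum of the trace. -/
theorem exWinsNode_of_mem_fixE {q : B.D} (hq : q ∈ fixE L B) :
    (satGame L B).ExWinsNode (.state q) := by
  classical
  have := B.finite
  obtain ⟨T, hT, hT'⟩ := exists_trace_nestedFix ⟨propagate L B, propagate_mono L B⟩
    (Propagates L B) B.Ω propagates_mono B.one_le_Ω (fun _ => rfl) (numPriorities χ) B.Ω_le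
    fun _ => ∅
  change ∀ q ∈ fixE L B, Propagates L B q {q' | q' ∈ fixE L B ∧ T q q'} at hT
  -- The first clause makes the strategy legal everywhere; the other two fix its moves at nodes
  -- belonging to `fixE`.
  have hmove : ∀ v : SatNode L B, ∃ v' : SatNode L B,
      ((∃ v'', SatMove L B v v'') → SatMove L B v v') ∧
      (∀ q ∈ fixE L B, v = .zero q → SatMove L B v v' ∧
        ∃ q', v' = .state q' ∧ q' ∈ fixE L B ∧ T q q') ∧
      (∀ q ∈ fixE L B, v = .one q → SatMove L B v v' ∧
        v' = .sels q {κ | B.δ q (.sel κ) ∈ fixE L B ∧ T q (B.δ q (.sel κ))}) := by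
    intro v
    by_cases h0 : ∃ q ∈ fixE L B, v = .zero q
    · obtain ⟨q, hq, rfl⟩ := h0
      obtain ⟨h1, h2, τ, h3⟩ := hT q hq
      refine ⟨.state (B.δ q (.choice τ)), fun _ => .choose q τ h2, fun q' _ h => ?_,
        fun _ _ h => nomatch h⟩
      cases h
      exact ⟨.choose q τ h2, _, rfl, h3⟩
    · by_cases h1 : ∃ q ∈ fixE L B, v = .one q
      · obtain ⟨q, hq, rfl⟩ := h1
        have hm := SatMove.select q _ (propagates_selections (hT q hq))
        refine ⟨_, fun _ => hm, fun _ _ h => (nomatch h), fun q' _ h => ?_⟩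
        cases h
        exact ⟨hm, rfl⟩
      · push Not at h0 h1
        by_cases h2 : ∃ v'', SatMove L B v v''
        · exact ⟨h2.choose, fun _ => h2.choose_spec, fun q hq h => absurd h (h0 q hq),
            fun q hq h => absurd h (h1 q hq)⟩
        · exact ⟨v, fun h => absurd h h2, fun q hq h => absurd h (h0 q hq),
            fun q hq h => absurd h (h1 q hq)⟩
  choose s hs hs0 hs1 using hmove
  -- Histories passed to the strategy are nonempty, so the default node is never used.
  refine ⟨fun h => s (h.getLast?.getD (.state q)), fun h v _ hv => ?_, fun π hπ0 hπ => ?_⟩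
  · change SatMove L B v _
    simpa using hs v hv
  replace hπ : ∀ n : ℕ, (n : ℕ∞) < π.last → π.node n ∈ (satGame L B).exNodes →
      π.node (n + 1) = s (π.node n) := fun n hn he => by
    rw [hπ n hn he, List.range_succ, List.map_append]
    simp
  have hinv : ∀ n : ℕ, (n : ℕ∞) ≤ π.last →
      (∃ q ∈ fixE L B, π.node n = .state q ∨ π.node n = .zero q ∨ π.node n = .one q) ∨
      ∃ q, π.node n = .sels q {κ | B.δ q (.sel κ) ∈ fixE L B ∧ T q (B.δ q (.sel κ))} := by
    intro n
    induction n with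
    | zero => exact fun _ => .inl ⟨q, hq, .inl hπ0⟩
    | succ n ih =>
      intro hn
      have hn' : (n : ℕ∞) < π.last :=
        lt_of_lt_of_le (by exact_mod_cast Nat.lt_succ_self n) hn
      have hm : SatMove L B (π.node n) (π.node (n + 1)) := π.move_node n hn'
      rcases ih hn'.le with ⟨q, hq, h | h | h⟩ | ⟨q, h⟩
      · rw [h] at hm
        generalize π.node (n + 1) = v at hm
        cases hm
        · exact .inl ⟨q, hq, .inr (.inl rfl)⟩
        · exact .inl ⟨q, hq, .inr (.inr rfl)⟩
      · rw [hπ n hn' ⟨q, .inl h⟩]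
        obtain ⟨-, q', h1, h2, -⟩ := hs0 _ q hq h
        exact .inl ⟨q', h2, .inl h1⟩
      · rw [hπ n hn' ⟨q, .inr h⟩]
        exact .inr ⟨q, (hs1 _ q hq h).2⟩
      · rw [h] at hm
        generalize π.node (n + 1) = v at hm
        cases hm with
        | step _ _ κ hκ => exact .inl ⟨_, hκ.1, .inl rfl⟩
  cases hlast : π.last using ENat.recTopCoe with
  | coe n =>
    refine .inl ⟨n, hlast, ?_⟩
    have hmax : ∀ v, ¬ SatMove L B (π.node n) v := π.maximal n hlast
    rintro ⟨q, he⟩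
    rcases hinv n hlast.ge with ⟨q', hq', h | h | h⟩ | ⟨q', h⟩
    · rw [h] at he; simp at he
    · exact hmax _ (hs0 _ q' hq' h).1
    · exact hmax _ (hs1 _ q' hq' h).1
    · rw [h] at he; simp at he
  | top =>
    refine .inr ⟨hlast, ?_⟩
    have hlt : ∀ n : ℕ, (n : ℕ∞) < π.last := fun n => hlast ▸ ENat.natCast_lt_top n
    have hm : ∀ n, SatMove L B (π.node n) (π.node (n + 1)) := fun n => π.move_node n (hlt n)
    obtain ⟨p, hp, hp'⟩ := exists_state_path π.node T ⟨q, hπ0⟩ (fun n q h => by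
      have hqE : q ∈ fixE L B := by
        rcases hinv n (hlt n).le with ⟨q', hq', h' | h' | h'⟩ | ⟨q', h'⟩ <;> rw [h] at h' <;>
          cases h'
        exact hq'
      have h1 := hm n
      rw [h] at h1
      generalize hv : π.node (n + 1) = v at h1
      cases h1
      · obtain ⟨-, q', h3, -, h4⟩ := hs0 _ q hqE hv
        exact .inl ⟨rfl, q', (hπ (n + 1) (hlt _) ⟨q, .inl hv⟩).trans h3, h4⟩
      · have h3 := (hπ (n + 1) (hlt _) ⟨q, .inr hv⟩).trans (hs1 _ q hqE hv).2
        have h4 := hm (n + 2)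
        rw [h3] at h4
        generalize hw : π.node (n + 2 + 1) = v at h4
        cases h4 with
        | step _ _ κ hκ => exact .inr ⟨rfl, ⟨_, h3⟩, _, rfl, hκ.2⟩)
    obtain ⟨m, hm1, hm2⟩ := hT' p hp
    exact ⟨m, hp' m hm1, hm2⟩

/-- Outside `fixE` the universal player can force every round along an edge of the complementary
trace unless his opponent gets stuck. Being positional, this counterstrategy works against any
history-dependent strategy. -/
theorem mem_fixE_of_exWinsNode {q : B.D} (hq : (satGame L B).ExWinsNode (.state q)) :
    q ∈ fixE L B := by
  classical
  by_contra hqE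
  have := B.finite
  obtain ⟨T, hT, hT'⟩ := exists_trace_compl_nestedFix ⟨propagate L B, propagate_mono L B⟩
    (Propagates L B) B.Ω propagates_mono B.one_le_Ω (fun _ => rfl) (numPriorities χ) B.Ω_le
    fun _ => ∅
  change ∀ q ∉ fixE L B, ¬ Propagates L B q {q' | q' ∉ fixE L B → ¬ T q q'} at hT
  obtain ⟨s, hs, hwin⟩ := hq
  let good : B.D → B.D → Prop := fun q q' => q' ∉ fixE L B ∧ T q q'
  -- `chooses` and `selects` express that moving to `(q, 0)`, respectively `(q, 1)`, is good for the
  -- universal player. `chooses` is vacuous if the label contains `⊥`, where his opponent is stuck.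
  let chooses : B.D → Prop := fun q => ∀ τ, ¬ HasBot L B q → good q (B.δ q (.choice τ))
  let selects : B.D → Prop := fun q => ∀ Ξ : Set (Selection χ),
    (sem1 L (modalLits L B q) (B.lab '' ((fun κ => B.δ q (.sel κ)) '' Ξ))).Nonempty →
    ∃ κ ∈ Ξ, good q (B.δ q (.sel κ))
  -- If both options failed, the bad choice and the bad set of selections would together satisfy the
  -- one-round condition that the trace refutes.
  have hcs : ∀ q ∉ fixE L B, ¬ chooses q → selects q := by
    intro q hq hc Ξ hΞ
    by_contra! hΞ'
    simp only [chooses, not_forall] at hc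
    obtain ⟨τ, hb, hτ⟩ := hc
    refine hT q hq ⟨sem1_nonempty_mono L _ (Set.image_mono ?_) hΞ, hb, τ,
      fun h h' => hτ ⟨h, h'⟩⟩
    rintro _ ⟨κ, hκ, rfl⟩
    exact ⟨⟨κ, rfl⟩, fun h h' => hΞ' κ hκ ⟨h, h'⟩⟩
  let t : SatNode L B → SatNode L B
    | .state q => if chooses q then .zero q else .one q
    | .sels q Ξ => if h : ∃ κ ∈ Ξ, good q (B.δ q (.sel κ)) then .state (B.δ q (.sel h.choose))
        else .zero q
    | v => v
  let I : Set (SatNode L B) := {v | match v with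
    | .state q => q ∉ fixE L B
    | .zero q => chooses q
    | .one q => selects q
    | .sels q Ξ => ∃ κ ∈ Ξ, good q (B.δ q (.sel κ))}
  have hnex : ∀ q, SatNode.state q ∉ (satGame L B).exNodes := by
    rintro q ⟨q', h⟩; simp at h
  have hnex' : ∀ q Ξ, SatNode.sels q Ξ ∉ (satGame L B).exNodes := by
    rintro q Ξ ⟨q', h⟩; simp at h
  have ht_sels : ∀ q Ξ, (SatNode.sels q Ξ : SatNode L B) ∈ I → ∃ κ ∈ Ξ,
      t (.sels q Ξ) = .state (B.δ q (.sel κ)) ∧ good q (B.δ q (.sel κ)) := by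
    intro q Ξ h
    exact ⟨_, h.choose_spec.1, dif_pos h, h.choose_spec.2⟩
  have ht_state : ∀ q, (SatNode.state q : SatNode L B) ∈ I →
      (t (.state q) = .zero q ∧ chooses q) ∨ (t (.state q) = .one q ∧ selects q) := by
    intro q h
    by_cases hc : chooses q
    · exact .inl ⟨if_pos hc, hc⟩
    · exact .inr ⟨if_neg hc, hcs q h hc⟩
  obtain ⟨π, hπ0, hπs, hπt, hπI⟩ := (satGame L B).exists_play hs t I
    (by
      intro v hv v' hm ht
      change SatMove L B v v' at hm
      cases hm with
      | to_zero q =>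
        rcases ht_state q hv with ⟨-, h⟩ | ⟨h, -⟩
        · exact h
        · cases (ht (hnex q)).trans h
      | to_one q =>
        rcases ht_state q hv with ⟨h, -⟩ | ⟨-, h⟩
        · cases (ht (hnex q)).trans h
        · exact h
      | choose q τ h => exact (hv τ h).1
      | select q Ξ h => exact hv Ξ h
      | step q Ξ κ h =>
        obtain ⟨κ', -, h1, h2⟩ := ht_sels q Ξ hv
        rw [ht (hnex' q Ξ), h1]
        exact h2.1)
    (by
      intro v hv he
      change SatMove L B v (t v)
      cases v with
      | state q =>
        rcases ht_state q hv with ⟨h, -⟩ | ⟨h, -⟩ <;> rw [h]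
        · exact .to_zero q
        · exact .to_one q
      | zero q => exact absurd ⟨q, .inl rfl⟩ he
      | one q => exact absurd ⟨q, .inr rfl⟩ he
      | sels q Ξ =>
        obtain ⟨κ, hκ, h1, -⟩ := ht_sels q Ξ hv
        rw [h1]
        exact .step q Ξ κ hκ)
    (.state q) hqE
  rcases hwin π hπ0 hπs with ⟨n, hn, hne⟩ | ⟨hlast, hev⟩
  · have hmax : ∀ v, ¬ SatMove L B (π.node n) v := π.maximal n hn
    have hmem := hπI n hn.ge
    generalize π.node n = v at hmax hne hmem
    cases v with
    | state q => exact hmax _ (.to_zero q)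
    | zero q => exact hne ⟨q, .inl rfl⟩
    | one q => exact hne ⟨q, .inr rfl⟩
    | sels q Ξ =>
      obtain ⟨κ, hκ, -⟩ := hmem
      exact hmax _ (.step q Ξ κ hκ)
  · have hlt : ∀ n : ℕ, (n : ℕ∞) < π.last := fun n => hlast ▸ ENat.natCast_lt_top n
    have hm : ∀ n, SatMove L B (π.node n) (π.node (n + 1)) := fun n => π.move_node n (hlt n)
    obtain ⟨p, hp, hp'⟩ := exists_state_path π.node T ⟨q, hπ0⟩ (fun n q h => by
      have h1 := hm n
      rw [h] at h1
      have hI1 := hπI (n + 1) (hlt _).le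
      have h2 := hm (n + 1)
      generalize hv : π.node (n + 1) = v at h1 h2 hI1
      cases h1
      · generalize hw : π.node (n + 1 + 1) = w at h2
        cases h2 with
        | choose _ τ hb => exact .inl ⟨rfl, _, rfl, (hI1 τ hb).2⟩
      · have hI2 := hπI (n + 2) (hlt _).le
        have h3 := hπt (n + 2) (hlt _)
        generalize hw : π.node (n + 1 + 1) = w at h2
        cases h2 with
        | select _ Ξ hΞ =>
          change π.node (n + 2) = _ at hw
          rw [hw] at hI2 h3
          obtain ⟨κ, -, h4, h5⟩ := ht_sels q Ξ hI2
          exact .inr ⟨rfl, ⟨Ξ, rfl⟩, _, (h3 (hnex' q Ξ)).trans h4, h5.2⟩)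
    obtain ⟨m, hm1, hm2⟩ := hT' p hp
    obtain ⟨m', hm3, hm4⟩ := hev
    -- The same play has an even maximum by the winning strategy and an odd one by the trace.
    have : m = m' := (hp' m hm1).unique hm3
    exact Nat.not_odd_iff_even.2 hm4 (this ▸ hm2)

end SatGame

end CoalgMu

theorem lemma4p7 (L : CoalgMu.CoalgLogic.{u}) (χ : CoalgMu.Formula L.Λ)
    (hwf : χ.WellFormed) (hclosed : χ.Closed) (hclean : χ.Clean)
    (B : CoalgMu.CoDetTracking.{u, w} χ) (q : B.D) :
    q ∈ CoalgMu.fixE L B ↔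
      (CoalgMu.satGame L B).ExWinsNode (CoalgMu.SatNode.state q) :=
  ⟨CoalgMu.exWinsNode_of_mem_fixE, CoalgMu.mem_fixE_of_exWinsNode⟩
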